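/- Let $\mathbb{F}_q$ be a finite field with $q$ elements and characteristic $p$, let $A=\mathbb{F}_q[\theta]$, $k=\mathbb{F}_q(\theta)$, and let $v\in A$ be a monic irreducible polynomial of degree $d$. Let $A_v\subset k_v$ be the completions of $A\subset k$ at $v$, and $\mathfrak m_v$ the maximal ideal of $A_v$. Put $\mathbb{Z}_{d,p}=\varprojlim_e \mathbb{Z}/(q^d-1)q^{de}\ (\cong\mathbb{Z}/(q^d-1)\times\mathbb{Z}_p)$. For $x\in A_v\setminus\mathfrak m_v$ and $t=(t_e)_e\in\mathbb{Z}_{d,p}$ let $x^t=\lim_{e\to\infty}x^{\tilde t_e}$, where $\tilde t_e\in\{0,\dots,(q^d-1)q^{de}-1\}$ represents $t_e$ (the limit exists). For $s=(\sigma,t)\in k_v^\times\times\mathbb{Z}_{d,p}$ and $n\in A$ prime to $v$ let $n^s=\sigma^{\deg n}n^t$, and for $i\ge 0$ let $\tilde S_i(s)=\sum n^{-s}$, summed over the monic $n\in A$ of degree $i$ that are prime to $v$. Put $$\zeta_v(s_1,\dots,s_r)=\sum_{i_1>\cdots>i_r\ge 0}\tilde S_{i_1}(s_1)\cdots\tilde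 S_{i_r}(s_r),\qquad \zeta_v^\star(s_1,\dots,s_r)=\sum_{i_1\ge\cdots\ge i_r\ge 0}\tilde S_{i_1}(s_1)\cdots\tilde S_{i_r}(s_r).$$ Let $\sigma_1,\dots,\sigma_r\in k_v\setminus\mathfrak m_v$ (for instance, $\sigma_j\in A_v\setminus\mathfrak m_v$). For compact open $U\subseteq A_v^r$ put $$\mu^{\sigma_1,\dots,\sigma_r}(U)=\sum_{i_1>\cdots>i_r\ge 0}\sigma_1^{-i_1}\cdots\sigma_r^{-i_r}\cdot\#\{(n_1,\dots,n_r)\in A^r\cap U:\ n_j \text{ monic},\ \deg n_j=i_j \text{ for all } j\},$$ and let $\mu^{\star\,\sigma_1,\dots,\sigma_r}(U)$ be the same sum over $i_1\ge\cdots\ge i_r\ge 0$. Then $\mu^{\sigma_1,\dots,\sigma_r}$ and $\mu^{\star\,\sigma_1,\dots,\sigma_r}$ are finitely additive $A_v$-valued measures on the compact open subsets of $A_v^r$. Their values at a set $(\alpha_1,\dots,\alpha_r)+\mathfrak m_v^{e_1}\times\cdots\times\mathfrak m_v^{e_r}$, with $\alpha_j\in A$ and $e_j\ge 0$, are the sums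 of the convergent series $$\sum_{i_1>\cdots>i_r\ge 0}\sigma_1^{-i_1}\cdots\sigma_r^{-i_r}\sum_{\substack{n_j\text{ monic},\ \deg n_j=i_j\\ n_j\equiv\alpha_j \bmod v^{e_j}}}1$$ and, for the star measure, of the same convergent series over $i_1\ge\cdots\ge i_r\ge 0$. Moreover, for all $t_1,\dots,t_r\in\mathbb{Z}_{d,p}$ the series defining $\zeta_v$ and $\zeta_v^\star$ at $((\sigma_1,-t_1),\dots,(\sigma_r,-t_r))$ converge, the following integrals exist as limits of Riemann sums over finite partitions of $(A_v\setminus\mathfrak m_v)^r$ into compact open sets, and $$\zeta_v((\sigma_1,-t_1),\dots,(\sigma_r,-t_r))=\int_{(A_v\setminus\mathfrak m_v)^r}x_1^{t_1}\cdots x_r^{t_r}\,d\mu^{\sigma_1,\dots,\sigma_r},$$ $$\zeta_v^\star((\sigma_1,-t_1),\dots,(\sigma_r,-t_r))=\int_{(A_v\setminus\mathfrak m_v)^r}x_1^{t_1}\cdots x_r^{t_r}\,d\mu^{\star\,\sigma_1,\dots,\sigma_r}.$$ -/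

import Mathlib

open Filter Topology Polynomial

noncomputable section

namespace VAdicMZ

/-! ### Completions of `A = 𝔽_q[θ]` and `k = 𝔽_q(θ)` at an irreducible polynomial `v` -/

section Completion

variable {F : Type*} [Field F] (v : F[X]) [hv : Fact (Irreducible v)]

/-- The place of `k = F(θ)` given by the prime ideal `(v)` of `A = F[θ]`. -/
def place : IsDedekindDomain.HeightOneSpectrum F[X] where
  asIdeal := Ideal.span {v}
  isPrime := (Ideal.span_singleton_prime hv.out.ne_zero).2 hv.out.prime
  ne_bot := by simpa using hv.out.ne_zero

/-- The completion `k_v` of `k = F(θ)` at `v`. -/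
abbrev Kv : Type _ := (place v).adicCompletion (RatFunc F)

/-- The completion `A_v` of `A = F[θ]` at `v`, as the valuation ring of `k_v`. -/
abbrev Av : ValuationSubring (Kv v) := (place v).adicCompletionIntegers (RatFunc F)

/-- The maximal ideal `𝔪_v` of `A_v`. -/
abbrev maxIdeal : Ideal (Av v) := IsLocalRing.maximalIdeal (Av v)

/-- The canonical map `A → A_v`. -/
def toAv (n : F[X]) : Av v := algebraMap F[X] (Av v) n

/-- The set `(A_v ∖ 𝔪_v)^r`. -/
def unitTuples (r : ℕ) : Set (Fin r → Av v) := {x | ∀ j, x j ∉ maxIdeal v}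

/-- The compact open set `(α_1, …, α_r) + 𝔪_v^{e_1} × ⋯ × 𝔪_v^{e_r}` of `A_v^r`. -/
def box {r : ℕ} (α : Fin r → F[X]) (e : Fin r → ℕ) : Set (Fin r → Av v) :=
  {x | ∀ j, x j - toAv v (α j) ∈ maxIdeal v ^ e j}

end Completion

/-! ### Exponents -/

/-- The projection `ℤ/(q^d-1)q^{d(e+1)} → ℤ/(q^d-1)q^{de}`. -/
def transition (q d e : ℕ) :
    ZMod ((q ^ d - 1) * q ^ (d * (e + 1))) →+* ZMod ((q ^ d - 1) * q ^ (d * e)) :=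
  ZMod.castHom (Nat.mul_dvd_mul_left _ (pow_dvd_pow q (Nat.mul_le_mul_left d e.le_succ))) _

/-- `ℤ_{d,p} = lim_e ℤ/(q^d-1)q^{de}`, as the ring of compatible sequences. -/
def Zdp (q d : ℕ) : Subring (∀ e : ℕ, ZMod ((q ^ d - 1) * q ^ (d * e))) where
  carrier := {t | ∀ e, transition q d e (t (e + 1)) = t e}
  mul_mem' ha hb e := by simp [ha e, hb e]
  one_mem' e := by simp
  add_mem' ha hb e := by simp [ha e, hb e]
  zero_mem' e := by simp
  neg_mem' ha e := by simp [ha e]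

section Power

variable {F : Type*} [Field F] (v : F[X]) [Fact (Irreducible v)]

/-- The exponents for `A_v`, where `q` is the order of `F` and `d` is the degree of `v`. -/
abbrev Exponent : Type := Zdp (Nat.card F) v.natDegree

/-- The elements `x ^ (t mod (q^d-1)q^{de})` of `A_v`, `e = 0, 1, …`, approximating `x ^ t`. -/
def powApprox (x : Av v) (t : Exponent v) (e : ℕ) : Av v := x ^ (t.1 e).val

/-- The power `x ^ t` for `x ∈ A_v ∖ 𝔪_v` and `t ∈ ℤ_{d,p}`, i.e. the limit of
`x ^ (t mod (q^d-1)q^{de})` for `e → ∞`. -/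
def vpow (x : Av v) (t : Exponent v) : Av v := limUnder atTop (powApprox v x t)

/-- The character space `X_v = k_vˣ × ℤ_{d,p}`. -/
abbrev Xv : Type _ := (Kv v)ˣ × Exponent v

/-- `n ^ s = σ ^ (deg n) n ^ t` for `s = (σ, t) ∈ X_v`. -/
def charPow (n : F[X]) (s : Xv v) : Kv v :=
  (s.1 : Kv v) ^ n.natDegree * (vpow v (toAv v n) s.2 : Kv v)

end Power

/-! ### Multiple zeta functions -/

lemma finite_monic (F : Type*) [Field F] [Finite F] (i : ℕ) :
    {n : F[X] | n.Monic ∧ n.natDegree = i}.Finite := by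
  have : Finite (degreeLT F (i + 1)) := Finite.of_equiv _ (degreeLTEquiv F (i + 1)).toEquiv.symm
  refine (Set.toFinite (degreeLT F (i + 1) : Set F[X])).subset fun n hn => ?_
  have h : n.degree < ((i + 1 : ℕ) : WithBot ℕ) :=
    (degree_le_natDegree).trans_lt (by rw [hn.2]; exact_mod_cast Nat.lt_succ_self i)
  exact mem_degreeLT.2 h

/-- The finite set of monic polynomials of degree `i`. -/
def monics (F : Type*) [Field F] [Finite F] (i : ℕ) : Finset F[X] := (finite_monic F i).toFinset

/-- Index set `i_1 > ⋯ > i_r ≥ 0`. -/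
abbrev StrictIdx (r : ℕ) : Type := {i : Fin r → ℕ // StrictAnti i}

/-- Index set `i_1 ≥ ⋯ ≥ i_r ≥ 0`. -/
abbrev WeakIdx (r : ℕ) : Type := {i : Fin r → ℕ // Antitone i}

section Zeta

variable {F : Type*} [Field F] [Finite F] (v : F[X]) [Fact (Irreducible v)]

open Classical in
/-- `S̃_i(s) = ∑ 1 / n ^ s` over the monic `n` of degree `i` that are prime to `v`. -/
def powerSum (s : Xv v) (i : ℕ) : Kv v :=
  ∑ n ∈ (monics F i).filter (fun n => IsCoprime n v), 1 / charPow v n s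

/-- `S̃_{i_1}(s_1) ⋯ S̃_{i_r}(s_r)`. -/
def zetaTerm {r : ℕ} (s : Fin r → Xv v) (i : Fin r → ℕ) : Kv v := ∏ j, powerSum v (s j) (i j)

/-- The `v`-adic multiple zeta function. -/
def vMZF {r : ℕ} (s : Fin r → Xv v) : Kv v := ∑' i : StrictIdx r, zetaTerm v s i.1

/-- The `v`-adic multiple zeta star function. -/
def vMZSF {r : ℕ} (s : Fin r → Xv v) : Kv v := ∑' i : WeakIdx r, zetaTerm v s i.1

open Classical in
/-- The tuples `(n_1, …, n_r)` of monic polynomials with `deg n_j = i_j` that satisfy `p`. -/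
def monicTuples {r : ℕ} (i : Fin r → ℕ) (p : (Fin r → F[X]) → Prop) : Finset (Fin r → F[X]) :=
  (Fintype.piFinset fun j => monics F (i j)).filter p

/-- `σ_1^{-i_1} ⋯ σ_r^{-i_r}` times the number of tuples in `monicTuples i p`. -/
def measureTerm {r : ℕ} (σ : Fin r → (Kv v)ˣ) (p : (Fin r → F[X]) → Prop) (i : Fin r → ℕ) :
    Kv v :=
  (∏ j, ((σ j : Kv v)⁻¹) ^ i j) * ((monicTuples i p).card : Kv v)

/-- The measure `μ^{σ_1, …, σ_r}`: its value at a compact open `U ⊆ A_v^r` is the sum of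
`σ_1^{-i_1} ⋯ σ_r^{-i_r} #{(n_1, …, n_r) ∈ U : n_j monic of degree i_j}` over `i_1 > ⋯ > i_r ≥ 0`. -/
def zetaMeasure {r : ℕ} (σ : Fin r → (Kv v)ˣ) (U : Set (Fin r → Av v)) : Kv v :=
  ∑' i : StrictIdx r, measureTerm v σ (fun n => (fun j => toAv v (n j)) ∈ U) i.1

/-- The star measure `μ^{⋆ σ_1, …, σ_r}`: the same sum over `i_1 ≥ ⋯ ≥ i_r ≥ 0`. -/
def zetaStarMeasure {r : ℕ} (σ : Fin r → (Kv v)ˣ) (U : Set (Fin r → Av v)) : Kv v :=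
  ∑' i : WeakIdx r, measureTerm v σ (fun n => (fun j => toAv v (n j)) ∈ U) i.1

end Zeta

/-! ### Measures on compact open sets and their integrals -/

section Measure

variable {X K : Type*} [TopologicalSpace X] [Ring K]

/-- `μ`, restricted to the compact open sets, is an `R`-valued (finitely additive) measure. -/
structure IsMeasureValuedIn (R : Set K) (μ : Set X → K) : Prop where
  mem : ∀ U, IsCompact U → IsOpen U → μ U ∈ R
  empty : μ ∅ = 0
  union : ∀ U V, IsCompact U → IsOpen U → IsCompact V → IsOpen V → Disjoint U V →
    μ (U ∪ V) = μ U + μ V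

/-- A finite partition of `S` into non-empty compact open sets. -/
def IsCompactOpenPartition {S : Set X} (P : Finpartition S) : Prop :=
  ∀ U ∈ P.parts, IsCompact U ∧ IsOpen U

/-- `∫_S f dμ` exists and equals `I`: the Riemann sums `∑_U f(ξ_U) μ(U)` over partitions of `S` into
compact open sets `U` with sample points `ξ_U ∈ U` converge to `I` along refinement. -/
def HasIntegral [TopologicalSpace K] (μ : Set X → K) (S : Set X) (f : X → K) (I : K) : Prop :=
  ∀ N ∈ 𝓝 I, ∃ P₀ : Finpartition S, IsCompactOpenPartition P₀ ∧
    ∀ P : Finpartition S, IsCompactOpenPartition P → P ≤ P₀ →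
      ∀ ξ : Set X → X, (∀ U ∈ P.parts, ξ U ∈ U) → ∑ U ∈ P.parts, f (ξ U) * μ U ∈ N

end Measure

end VAdicMZ

end

/-! Everything rests on a cancellation modulo `p`. Let `φ` be a function on `A ^ r` that depends
only on residues modulo `w ≠ 0`, and let some `i_j > deg w`. Translating `n_j` by `c w`, `c ∈ 𝔽_q`,
permutes the monic tuples of degrees `i` and sorts them into `q` classes with equal sums of `φ`, so
the total is `0` (`sum_monics_eq_zero`). If `φ` is only `v`-adically uniformly continuous, the same
argument with `w = v ^ e` makes the total small (`sum_monics_mem`). Since `σ_j⁻¹ ∈ A_v`, the weights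
do no harm, and the weighted sums tend to `0` along all of `ℕ ^ r`; hence they are summable over any
index set, strict or weak (`summable_weightedSum`).

Measure and zeta value are both such sums: `φ` is the indicator of `U` for the former, and `x ^ t`
extended by zero from the unit tuples for the latter. A Riemann sum for a fine partition comes from
a `φ` that is uniformly close to the second one, and integral weights preserve closeness
(`hasIntegral_tupleMeasure`). -/

noncomputable section

namespace VAdicMZ
-- The `v`-adic filtration of `k_v` and compactness of `A_v`.
section Local
open WithZero
variable {F : Type*} [Field F] (v : F[X]) [hv : Fact (Irreducible v)]

/-- The elements of `k_v` that are divisible by `v ^ e` in `A_v`. -/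
def level (e : ℕ) : AddSubgroup (Kv v) where
  carrier := {x | Valued.v x ≤ exp (-(e : ℤ))}
  zero_mem' := by simp
  add_mem' ha hb := by
    rw [Set.mem_ofPred_eq] at *
    exact (Valuation.map_add _ _ _).trans (max_le ha hb)
  neg_mem' ha := by simpa using ha

lemma mem_level {e : ℕ} {x : Kv v} : x ∈ level v e ↔ Valued.v x ≤ exp (-(e : ℤ)) := by
  rw [← SetLike.mem_coe]
  exact Set.mem_ofPred

lemma level_anti {e e' : ℕ} (h : e ≤ e') : level v e' ≤ level v e := fun x hx => by
  rw [mem_level] at *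
  refine hx.trans ?_
  rw [exp_le_exp]
  omega

lemma mem_level_zero {x : Kv v} : x ∈ level v 0 ↔ x ∈ Av v := by
  rw [mem_level, IsDedekindDomain.HeightOneSpectrum.mem_adicCompletionIntegers]
  simp

lemma mul_mem_level {e : ℕ} {a x : Kv v} (ha : a ∈ Av v) (hx : x ∈ level v e) :
    a * x ∈ level v e := by
  rw [mem_level] at *
  rw [map_mul]
  rw [IsDedekindDomain.HeightOneSpectrum.mem_adicCompletionIntegers] at ha
  exact (mul_le_of_le_one_left' ha).trans hx

variable {v} in
lemma prod_weight_mem {r : ℕ} {σ : Fin r → (Kv v)ˣ} (hσ : ∀ j, (σ j : Kv v)⁻¹ ∈ Av v)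
    (i : Fin r → ℕ) : ∏ j, ((σ j : Kv v)⁻¹) ^ i j ∈ Av v :=
  prod_mem fun j _ => pow_mem (hσ j) _

lemma valued_toAv (n : F[X]) : Valued.v (toAv v n : Kv v) = (place v).intValuation n := by
  rw [← (place v).valuation_of_algebraMap (K := RatFunc F)]
  exact (place v).valuedAdicCompletion_eq_valuation' _

lemma toAv_mem_level {n : F[X]} {e : ℕ} : (toAv v n : Kv v) ∈ level v e ↔ v ^ e ∣ n := by
  rw [mem_level, valued_toAv, IsDedekindDomain.HeightOneSpectrum.intValuation_le_pow_iff_mem]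
  simp [place, Ideal.span_singleton_pow, Ideal.mem_span_singleton]

lemma valued_toAv_self : Valued.v (toAv v v : Kv v) = exp (-1 : ℤ) := by
  rw [valued_toAv]
  exact (place v).intValuation_singleton hv.out.ne_zero rfl

lemma mem_maxIdeal {x : Av v} : x ∈ maxIdeal v ↔ (x : Kv v) ∈ level v 1 := by
  rw [IsLocalRing.mem_maximalIdeal, mem_nonunits_iff,
    IsDedekindDomain.HeightOneSpectrum.adicCompletionIntegers.isUnit_iff_valued_eq_one, mem_level]
  have hx : Valued.v (x : Kv v) ≤ 1 := x.2
  generalize Valued.v (x : Kv v) = y at *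
  rw [← ne_eq, ← hx.lt_iff_ne]
  -- The value group is discrete: below `1` means at most `exp (-1)`.
  cases y using WithZero.expRecOn with
  | zero => simp
  | exp n =>
    rw [← exp_zero, exp_lt_exp, exp_le_exp]
    omega

/-- The image of `v` is a uniformizer: dividing by its powers stays in `A_v`, so it generates the
maximal ideal. -/
lemma mem_maxIdeal_pow {x : Av v} {e : ℕ} : x ∈ maxIdeal v ^ e ↔ (x : Kv v) ∈ level v e := by
  have h0 : (toAv v v : Kv v) ≠ 0 := by
    intro h
    have := valued_toAv_self v
    rw [h, map_zero] at this
    exact exp_ne_zero this.symm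
  have key (e : ℕ) (x : Av v) (h : (x : Kv v) ∈ level v e) : x ∈ Ideal.span {toAv v v ^ e} := by
    refine Ideal.mem_span_singleton'.2 ⟨⟨x / toAv v v ^ e, ?_⟩, ?_⟩
    · rw [IsDedekindDomain.HeightOneSpectrum.mem_adicCompletionIntegers, map_div₀, map_pow,
        valued_toAv_self, ← exp_nsmul]
      apply div_le_one_of_le₀ _ zero_le
      simpa [mem_level] using h
    · apply Subtype.ext
      simp [h0]
  have hmax : maxIdeal v = Ideal.span {toAv v v} := by
    apply le_antisymm
    · intro x hx
      simpa using key 1 x ((mem_maxIdeal v).1 hx)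
    · rw [Ideal.span_singleton_le_iff_mem, mem_maxIdeal, toAv_mem_level]
      simp
  rw [hmax, Ideal.span_singleton_pow]
  refine ⟨fun h => ?_, key e x⟩
  obtain ⟨a, rfl⟩ := Ideal.mem_span_singleton'.1 h
  refine mul_mem_level v a.2 ?_
  have := (toAv_mem_level v (n := v ^ e) (e := e)).2 dvd_rfl
  simpa [toAv] using this

lemma mem_level_iff_restrict {x : Kv v} {e : ℕ} :
    x ∈ level v e ↔ Valued.v.restrict x ≤ Valued.v.restrict ((toAv v v : Kv v) ^ e) := by
  rw [mem_level, Valuation.restrict_le_iff, map_pow, valued_toAv_self, ← exp_nsmul]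
  simp

lemma isOpen_level (e : ℕ) : IsOpen (level v e : Set (Kv v)) := by
  have h0 : Valued.v ((toAv v v : Kv v) ^ e) ≠ 0 := by
    rw [map_pow, valued_toAv_self, ← exp_nsmul]
    exact exp_ne_zero
  convert Valued.isOpen_closedBall (Kv v) (r := Valued.v.restrict ((toAv v v : Kv v) ^ e)) ?_
  · ext x
    rw [SetLike.mem_coe, mem_level_iff_restrict, Set.mem_ofPred_eq]
  · simpa using h0

lemma isClosed_level (e : ℕ) : IsClosed (level v e : Set (Kv v)) :=
  AddSubgroup.isClosed_of_isOpen _ (isOpen_level v e)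

/-- Powers of the uniformizer tend to `0`, so their valuations drop below any radius. -/
lemma exists_level_subset {N : Set (Kv v)} (hN : N ∈ 𝓝 (0 : Kv v)) :
    ∃ e, (level v e : Set (Kv v)) ⊆ N := by
  obtain ⟨γ, hγ⟩ := Valued.mem_nhds_zero.1 hN
  have ht := Valued.tendsto_zero_pow_of_le_exp_neg_one (valued_toAv_self v).le
  have hm : {x : Kv v | Valued.v.restrict x < γ.1} ∈ 𝓝 (0 : Kv v) :=
    Valued.mem_nhds_zero.2 ⟨γ, subset_rfl⟩
  obtain ⟨e, he⟩ := (ht.eventually_mem hm).exists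
  refine ⟨e, fun x hx => hγ ?_⟩
  rw [Set.mem_ofPred_eq] at *
  exact ((mem_level_iff_restrict v).1 hx).trans_lt he

lemma tendsto_zero_of_mem_level {f : ℕ → Kv v} (hf : ∀ e, f e ∈ level v e) :
    Tendsto f atTop (𝓝 0) := by
  refine tendsto_def.2 fun N hN => ?_
  obtain ⟨e, he⟩ := exists_level_subset v hN
  filter_upwards [eventually_ge_atTop e] with k hk
  exact he (level_anti v hk (hf k))

lemma exists_level_add_subset {N : Set (Kv v)} {a : Kv v} (hN : N ∈ 𝓝 a) :
    ∃ e, ∀ x, x - a ∈ level v e → x ∈ N := by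
  have : (fun y => y + a) ⁻¹' N ∈ 𝓝 (0 : Kv v) :=
    (continuous_add_const a).continuousAt.preimage_mem_nhds (by simpa using hN)
  obtain ⟨e, he⟩ := exists_level_subset v this
  exact ⟨e, fun x hx => by simpa using he hx⟩

instance : NonarchimedeanRing (Kv v) where
  is_nonarchimedean U hU := by
    obtain ⟨e, he⟩ := exists_level_subset v hU
    exact ⟨⟨level v e, isOpen_level v e⟩, he⟩

/-- Two approximations: `k` is dense in `k_v`, and a `v`-integral element of `k` is close to a
polynomial. -/
lemma exists_toAv_sub_mem (x : Av v) (e : ℕ) : ∃ n : F[X], x - toAv v n ∈ maxIdeal v ^ e := by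
  have hopen : {y : Kv v | y - x ∈ level v e} ∈ 𝓝 (x : Kv v) := by
    refine ((isOpen_level v e).preimage (continuous_sub_right (x : Kv v))).mem_nhds ?_
    simp
  obtain ⟨y, hy⟩ := ((place v).denseRange_algebraMap (K := RatFunc F)).mem_nhds hopen
  rw [Set.mem_ofPred_eq] at hy
  have hyv : Valued.v (algebraMap (RatFunc F) (Kv v) y) = (place v).valuation (RatFunc F) y :=
    (place v).valuedAdicCompletion_eq_valuation' _
  have hyA : algebraMap (RatFunc F) (Kv v) y ∈ Av v := by
    have := add_mem ((mem_level_zero v).1 (level_anti v (Nat.zero_le e) hy)) x.2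
    simpa using this
  rw [IsDedekindDomain.HeightOneSpectrum.mem_adicCompletionIntegers, hyv] at hyA
  obtain ⟨n, hn⟩ := (place v).exists_valuation_sub_lt_of_integer hyA
    (Units.mk0 (exp (-(e : ℤ))) exp_ne_zero)
  refine ⟨n, ?_⟩
  rw [mem_maxIdeal_pow]
  have h2 : algebraMap (RatFunc F) (Kv v) (algebraMap F[X] (RatFunc F) n - y) ∈ level v e := by
    rw [mem_level]
    exact ((place v).valuedAdicCompletion_eq_valuation' _).trans_le hn.le
  rw [map_sub] at h2
  have := neg_mem (add_mem h2 hy)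
  convert this using 1
  simp only [AddSubgroupClass.coe_sub, toAv, sub_add_sub_cancel, neg_sub]
  rfl

lemma toAv_sub_mem {n m : F[X]} {e : ℕ} :
    toAv v n - toAv v m ∈ maxIdeal v ^ e ↔ v ^ e ∣ n - m := by
  rw [mem_maxIdeal_pow, ← toAv_mem_level]
  simp [toAv]

lemma toAv_mem_maxIdeal {n : F[X]} : toAv v n ∈ maxIdeal v ↔ v ∣ n := by
  rw [mem_maxIdeal, toAv_mem_level, pow_one]

lemma isCoprime_iff_toAv {n : F[X]} : IsCoprime n v ↔ toAv v n ∉ maxIdeal v := by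
  rw [toAv_mem_maxIdeal, isCoprime_comm, hv.out.coprime_iff_not_dvd]

/-- Uniform continuity for the `v`-adic topology on `A ^ r`. -/
def VAdicUniform {r : ℕ} (φ : (Fin r → F[X]) → Kv v) : Prop :=
  ∀ N : ℕ, ∃ e : ℕ, ∀ n m, (∀ j, v ^ e ∣ n j - m j) → φ n - φ m ∈ level v N

lemma isOpen_maxIdeal_pow (e : ℕ) : IsOpen ((maxIdeal v ^ e : Ideal (Av v)) : Set (Av v)) := by
  convert (isOpen_level v e).preimage continuous_subtype_val
  ext x
  simp [mem_maxIdeal_pow]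

lemma isClosed_maxIdeal_pow (e : ℕ) : IsClosed ((maxIdeal v ^ e : Ideal (Av v)) : Set (Av v)) := by
  convert (isClosed_level v e).preimage continuous_subtype_val
  ext x
  simp [mem_maxIdeal_pow]

lemma isClosed_Av : IsClosed (Av v : Set (Kv v)) := by
  convert isClosed_level v 0
  ext x
  simp only [SetLike.mem_coe, mem_level_zero]

lemma finite_reps [Finite F] (e : ℕ) : {n : F[X] | n.degree < (v ^ e).degree}.Finite := by
  have : Finite (degreeLT F (v ^ e).natDegree) :=
    Finite.of_equiv _ (degreeLTEquiv F (v ^ e).natDegree).toEquiv.symm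
  refine (Set.toFinite (degreeLT F (v ^ e).natDegree : Set F[X])).subset fun n hn => ?_
  rw [SetLike.mem_coe, mem_degreeLT, ← degree_eq_natDegree (pow_ne_zero _ hv.out.ne_zero)]
  exact hn

lemma exists_rep (x : Av v) (e : ℕ) :
    ∃ n : F[X], n.degree < (v ^ e).degree ∧ x - toAv v n ∈ maxIdeal v ^ e := by
  obtain ⟨n, hn⟩ := exists_toAv_sub_mem v x e
  refine ⟨n % v ^ e, degree_mod_lt _ (pow_ne_zero _ hv.out.ne_zero), ?_⟩
  rw [← sub_add_sub_cancel x (toAv v n)]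
  refine add_mem hn ((toAv_sub_mem v).2 ?_)
  exact ⟨n / v ^ e, sub_eq_iff_eq_add'.2 (EuclideanDomain.mod_add_div n (v ^ e)).symm⟩

instance : IsTopologicalRing (Av v) :=
  inferInstanceAs (IsTopologicalRing (Av v).toSubring)

/-- `A_v` is closed in a complete field, and the finitely many remainders modulo `v ^ e` represent
all its cosets of `𝔪_v ^ e`. -/
instance [Finite F] : CompactSpace (Av v) := by
  refine isCompact_iff_compactSpace (s := (Av v : Set (Kv v))).1 ?_
  rw [isCompact_iff_totallyBounded_isComplete]
  refine ⟨totallyBounded_iff_subset_finite_iUnion_nhds_zero.2 fun U hU => ?_,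
    (isClosed_Av v).isComplete⟩
  obtain ⟨e, he⟩ := exists_level_subset v hU
  refine ⟨_, (finite_reps v e).image fun n => (toAv v n : Kv v), fun x hx => ?_⟩
  obtain ⟨n, hn, hxn⟩ := exists_rep v ⟨x, hx⟩ e
  simp only [Set.mem_iUnion]
  refine ⟨_, ⟨n, hn, rfl⟩, ?_⟩
  rw [Set.mem_vadd_set_iff_neg_vadd_mem]
  apply he
  rw [mem_maxIdeal_pow] at hxn
  simpa [neg_add_eq_sub] using hxn

end Local

/-! ### Powers with exponents in `ℤ_{d,p}`. -/

section Powers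
variable {F : Type*} [Field F] [Finite F] (v : F[X]) [hv : Fact (Irreducible v)]

lemma lt_card_pow (e : ℕ) : e < Nat.card F ^ (v.natDegree * e) := by
  refine (Nat.lt_pow_self (Finite.one_lt_card (α := F))).trans_le ?_
  exact Nat.pow_le_pow_right Nat.card_pos (Nat.le_mul_of_pos_left _ (hv.out.natDegree_pos))

lemma card_pow_sub_one_pos : 0 < Nat.card F ^ v.natDegree - 1 :=
  Nat.sub_pos_of_lt (Nat.one_lt_pow (hv.out.natDegree_pos).ne' (Finite.one_lt_card (α := F)))

instance (e : ℕ) :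
    NeZero ((Nat.card F ^ v.natDegree - 1) * Nat.card F ^ (v.natDegree * e)) :=
  ⟨(Nat.mul_pos (card_pow_sub_one_pos v) (pow_pos Nat.card_pos _)).ne'⟩

/-- Fermat's little theorem in the field `A / v` with `q ^ d` elements. -/
lemma dvd_pow_card_sub_one {n : F[X]} (hn : ¬ v ∣ n) :
    v ∣ n ^ (Nat.card F ^ v.natDegree - 1) - 1 := by
  have hfin : Module.Finite F (AdjoinRoot v) :=
    (AdjoinRoot.powerBasis hv.out.ne_zero).finite
  have : Finite (AdjoinRoot v) := Module.finite_of_finite F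
  have hcard : Nat.card (AdjoinRoot v) = Nat.card F ^ v.natDegree := by
    rw [Module.natCard_eq_pow_finrank (K := F), (AdjoinRoot.powerBasis hv.out.ne_zero).finrank,
      AdjoinRoot.powerBasis_dim]
  have := Fintype.ofFinite (AdjoinRoot v)
  rw [← AdjoinRoot.mk_eq_zero] at hn ⊢
  rw [map_sub, map_pow, map_one, ← hcard, Nat.card_eq_fintype_card,
    FiniteField.pow_card_sub_one_eq_one _ hn, sub_self]

lemma pow_card_sub_one_mem {x : Av v} (hx : x ∉ maxIdeal v) :
    x ^ (Nat.card F ^ v.natDegree - 1) - 1 ∈ maxIdeal v := by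
  obtain ⟨n, hn⟩ := exists_toAv_sub_mem v x 1
  rw [pow_one] at hn
  have hn' : ¬ v ∣ n := fun h => hx (by
    simpa using add_mem hn ((toAv_mem_maxIdeal v).2 h))
  have h1 := (toAv_mem_maxIdeal v).2 (dvd_pow_card_sub_one v hn')
  rw [← Ideal.Quotient.eq_zero_iff_mem] at h1 ⊢
  rw [← Ideal.Quotient.eq] at hn
  simpa [toAv, hn] using h1

instance : CharP (Av v) (ringChar F) :=
  charP_of_injective_algebraMap (FaithfulSMul.algebraMap_injective F[X] (Av v)) (ringChar F)

lemma card_cast_eq_zero (R : Type*) [Ring R] [CharP R (ringChar F)] :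
    (Nat.card F : R) = 0 := by
  rw [CharP.cast_eq_zero_iff R (ringChar F), ← CharP.cast_eq_zero_iff F (ringChar F)]
  have := Fintype.ofFinite F
  rw [Nat.card_eq_fintype_card]
  exact FiniteField.cast_card_eq_zero F

/-- With `y = x ^ (q ^ d - 1) ∈ 1 + 𝔪_v`, Frobenius gives `y ^ Q - 1 = (y - 1) ^ Q ∈ 𝔪_v ^ Q` for `Q
= q ^ (d e)`, and `Q > e`. -/
lemma pow_sub_pow_mem_of_le {x : Av v} (hx : x ∉ maxIdeal v) {k l e : ℕ} (hkl : l ≤ k)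
    (h : (Nat.card F ^ v.natDegree - 1) * Nat.card F ^ (v.natDegree * e) ∣ k - l) :
    x ^ k - x ^ l ∈ maxIdeal v ^ e := by
  obtain ⟨c, hc⟩ := h
  obtain rfl : k = l + (Nat.card F ^ v.natDegree - 1) * Nat.card F ^ (v.natDegree * e) * c := by
    omega
  have := Fintype.ofFinite F
  obtain ⟨n, hp, hq⟩ := FiniteField.card F (ringChar F)
  have : ExpChar (Av v) (ringChar F) := .prime hp
  set y := x ^ (Nat.card F ^ v.natDegree - 1) with hy
  have h1 : y ^ Nat.card F ^ (v.natDegree * e) - 1 ∈ maxIdeal v ^ e := by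
    have : y ^ Nat.card F ^ (v.natDegree * e) - 1 = (y - 1) ^ Nat.card F ^ (v.natDegree * e) := by
      rw [Nat.card_eq_fintype_card, hq, ← pow_mul (ringChar F), sub_pow_expChar_pow, one_pow]
    rw [this]
    exact Ideal.pow_le_pow_right (lt_card_pow v e).le
      (Ideal.pow_mem_pow (pow_card_sub_one_mem v hx) _)
  rw [pow_add, ← mul_sub_one]
  refine Ideal.mul_mem_left _ _ ?_
  rw [pow_mul, pow_mul, ← hy]
  exact Ideal.mem_of_dvd _ (sub_one_dvd_pow_sub_one _ _) h1

lemma pow_sub_pow_mem {x : Av v} (hx : x ∉ maxIdeal v) {k l e : ℕ}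
    (h : k ≡ l [MOD (Nat.card F ^ v.natDegree - 1) * Nat.card F ^ (v.natDegree * e)]) :
    x ^ k - x ^ l ∈ maxIdeal v ^ e := by
  rcases le_total l k with hkl | hkl
  · exact pow_sub_pow_mem_of_le v hx hkl ((Nat.modEq_iff_dvd' hkl).1 h.symm)
  · rw [← neg_sub]
    exact neg_mem (pow_sub_pow_mem_of_le v hx hkl ((Nat.modEq_iff_dvd' hkl).1 h))

lemma powApprox_succ_sub_mem {x : Av v} (hx : x ∉ maxIdeal v) (t : Exponent v) (e : ℕ) :
    powApprox v x t (e + 1) - powApprox v x t e ∈ maxIdeal v ^ e := by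
  refine pow_sub_pow_mem v hx ?_
  rw [← ZMod.natCast_eq_natCast_iff]
  have := t.2 e
  rw [← ZMod.natCast_zmod_val (t.1 (e + 1)), map_natCast] at this
  rw [this, ZMod.natCast_zmod_val]

lemma tendsto_powApprox {x : Av v} (hx : x ∉ maxIdeal v) (t : Exponent v) :
    Tendsto (powApprox v x t) atTop (𝓝 (vpow v x t)) := by
  have ht : Tendsto (fun e => (powApprox v x t (e + 1) : Kv v) - powApprox v x t e)
      atTop (𝓝 0) := tendsto_zero_of_mem_level v fun e => by
    have := powApprox_succ_sub_mem v hx t e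
    rwa [mem_maxIdeal_pow, AddSubgroupClass.coe_sub] at this
  -- In a nonarchimedean group it suffices that consecutive differences tend to `0`.
  have hc : CauchySeq (fun e => (powApprox v x t e : Kv v)) :=
    NonarchimedeanAddGroup.cauchySeq_of_tendsto_sub_nhds_zero ht
  obtain ⟨y, hy⟩ := cauchySeq_tendsto_of_complete hc
  have hyA : y ∈ Av v := (isClosed_Av v).mem_of_tendsto hy (.of_forall fun e => Subtype.prop _)
  exact tendsto_nhds_limUnder ⟨⟨y, hyA⟩, tendsto_subtype_rng.2 hy⟩

lemma vpow_sub_vpow_mem {x y : Av v} (hx : x ∉ maxIdeal v) (hy : y ∉ maxIdeal v) {e : ℕ}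
    (h : x - y ∈ maxIdeal v ^ e) (t : Exponent v) :
    vpow v x t - vpow v y t ∈ maxIdeal v ^ e := by
  refine (isClosed_maxIdeal_pow v e).mem_of_tendsto
    ((tendsto_powApprox v hx t).sub (tendsto_powApprox v hy t)) (.of_forall fun k => ?_)
  exact Ideal.mem_of_dvd _ (sub_dvd_pow_sub_pow x y _) h

/-- The representatives of `-t` and `t` add up to a multiple of the modulus, though not always to
`0`, so the product of approximations is only `1` modulo `𝔪_v ^ e`. -/
lemma vpow_neg_mul_vpow {x : Av v} (hx : x ∉ maxIdeal v) (t : Exponent v) :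
    vpow v x (-t) * vpow v x t = 1 := by
  refine tendsto_nhds_unique ((tendsto_powApprox v hx (-t)).mul (tendsto_powApprox v hx t)) ?_
  rw [tendsto_subtype_rng, ← tendsto_sub_nhds_zero_iff]
  refine tendsto_zero_of_mem_level v fun e => ?_
  have : x ^ (((-t).1 e).val + (t.1 e).val) - x ^ 0 ∈ maxIdeal v ^ e := by
    refine pow_sub_pow_mem v hx ?_
    rw [← ZMod.natCast_eq_natCast_iff]
    simp
  rw [mem_maxIdeal_pow, pow_add, pow_zero] at this
  exact this

end Powers

/-! ### Cancellation in sums over monic polynomials. -/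

lemma mem_monics {F : Type*} [Field F] [Finite F] {i : ℕ} {n : F[X]} :
    n ∈ monics F i ↔ n.Monic ∧ n.natDegree = i := by
  simp [monics]

section Cancellation
variable {F : Type*} [Field F] [Finite F]

lemma add_C_mul_mem_monics {w : F[X]} {i : ℕ} (hi : w.natDegree < i) {n : F[X]}
    (hn : n ∈ monics F i) (c : F) : n + C c * w ∈ monics F i := by
  rw [mem_monics] at *
  have hd : (C c * w).natDegree < n.natDegree :=
    (natDegree_C_mul_le c w).trans_lt (hi.trans_eq hn.2.symm)
  exact ⟨hn.1.add_of_left (degree_lt_degree hd),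
    (natDegree_add_eq_left_of_natDegree_lt hd).trans hn.2⟩

/-- A function that is invariant under translation of the `j`-th argument by multiples of `w` sums
to zero over the monic polynomials of a degree larger than that of `w`. -/
lemma sum_monics_eq_zero {R : Type*} [Ring R] [CharP R (ringChar F)] {w : F[X]} (hw : w ≠ 0)
    {r : ℕ} (g : (Fin r → F[X]) → R) (i : Fin r → ℕ) (j : Fin r) (hi : w.natDegree < i j)
    (hg : ∀ n c, g (Function.update n j (n j + C c * w)) = g n) :
    ∑ n ∈ Fintype.piFinset (fun j => monics F (i j)), g n = 0 := by
  classical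
  have := Fintype.ofFinite F
  have hl : w.leadingCoeff ≠ 0 := leadingCoeff_ne_zero.2 hw
  set S := Fintype.piFinset (fun j => monics F (i j))
  let coef (n : Fin r → F[X]) : F := (n j).coeff w.natDegree
  let T (c : F) (n : Fin r → F[X]) : Fin r → F[X] := Function.update n j (n j + C c * w)
  have hT (c : F) {n} (hn : n ∈ S) : T c n ∈ S := by
    rw [Fintype.mem_piFinset] at *
    intro k
    rcases eq_or_ne k j with rfl | hk
    · simpa [T] using add_C_mul_mem_monics hi (hn k) c
    · simpa [T, hk] using hn k
  have hcoef (c : F) (n) : coef (T c n) = coef n + c * w.leadingCoeff := by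
    simp [coef, T]
  have hTT (c : F) (n) : T (-c) (T c n) = n := by
    simp [T]
  -- Tuples are sorted by the coefficient of `n_j` in degree `deg w`. Adding `c w` shifts it by `c`
  -- times the leading coefficient of `w`, so translations identify the `q` fibres.
  rw [← Finset.sum_fiberwise S coef g]
  have key (a : F) : ∑ n ∈ S with coef n = a, g n = ∑ n ∈ S with coef n = 0, g n := by
    refine Finset.sum_nbij' (T (-(a / w.leadingCoeff))) (T (a / w.leadingCoeff)) ?_ ?_ ?_ ?_ ?_
    · intro n hn
      rw [Finset.mem_filter] at *
      refine ⟨hT _ hn.1, ?_⟩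
      rw [hcoef, hn.2, neg_mul, div_mul_cancel₀ _ hl, add_neg_cancel]
    · intro n hn
      rw [Finset.mem_filter] at *
      refine ⟨hT _ hn.1, ?_⟩
      rw [hcoef, hn.2, div_mul_cancel₀ _ hl, zero_add]
    · intro n _
      simpa using hTT (-(a / w.leadingCoeff)) n
    · intro n _
      exact hTT _ n
    · intro n _
      exact (hg n _).symm
  rw [Finset.sum_congr rfl fun a _ => key a, Finset.sum_const, nsmul_eq_mul, Finset.card_univ,
    ← Nat.card_eq_fintype_card, card_cast_eq_zero, zero_mul]

/-- A function that is invariant modulo `G` under congruence modulo `w` has a sum in `G` over the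
monic polynomials of a degree larger than that of `w`. -/
lemma sum_monics_mem {R : Type*} [Ring R] [CharP R (ringChar F)] {w : F[X]} (hw : w ≠ 0)
    (G : AddSubgroup R) {r : ℕ} (g : (Fin r → F[X]) → R) (i : Fin r → ℕ) (j : Fin r)
    (hi : w.natDegree < i j) (hg : ∀ n m, (∀ j, w ∣ n j - m j) → g n - g m ∈ G) :
    ∑ n ∈ Fintype.piFinset (fun j => monics F (i j)), g n ∈ G := by
  -- Reducing the arguments modulo `w` makes the invariance exact and changes each value by an
  -- element of `G`.
  have h0 := sum_monics_eq_zero hw (fun n => g fun k => n k % w) i j hi fun n c => by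
    congr 1
    funext k
    rcases eq_or_ne k j with rfl | hk
    · rw [Function.update_self, add_mod, EuclideanDomain.mod_eq_zero.2 (dvd_mul_left w _), add_zero]
    · rw [Function.update_of_ne hk]
  rw [← sub_zero (∑ n ∈ _, g n), ← h0, ← Finset.sum_sub_distrib]
  exact sum_mem fun n _ => hg _ _ fun k =>
    ⟨n k / w, sub_eq_iff_eq_add'.2 (EuclideanDomain.mod_add_div (n k) w).symm⟩

end Cancellation

/-! ### Convergence of weighted sums. -/

section WeightedSum
variable {F : Type*} [Field F] [Finite F] (v : F[X]) [hv : Fact (Irreducible v)] {r : ℕ}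

/-- The sum of `φ` over the tuples of monic polynomials of degrees `i_1, …, i_r`, times
`σ_1^{-i_1} ⋯ σ_r^{-i_r}`. -/
def weightedSum (σ : Fin r → (Kv v)ˣ) (φ : (Fin r → F[X]) → Kv v) (i : Fin r → ℕ) : Kv v :=
  (∏ j, ((σ j : Kv v)⁻¹) ^ i j) * ∑ n ∈ Fintype.piFinset (fun j => monics F (i j)), φ n

instance : CharP (Kv v) (ringChar F) :=
  charP_of_injective_algebraMap (FaithfulSMul.algebraMap_injective (Av v) (Kv v)) (ringChar F)

variable {v} {σ : Fin r → (Kv v)ˣ}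

lemma weightedSum_mem_level (hσ : ∀ j, (σ j : Kv v)⁻¹ ∈ Av v) {φ : (Fin r → F[X]) → Kv v}
    {N : ℕ} (hφ : ∀ n, φ n ∈ level v N) (i : Fin r → ℕ) : weightedSum v σ φ i ∈ level v N :=
  mul_mem_level v (prod_weight_mem hσ i) (sum_mem fun n _ => hφ n)

/-- In a complete nonarchimedean group, terms tending to `0` suffice. A term outside `level v N`
forces every `i_j ≤ deg (v ^ e)`, which leaves finitely many `i`. The condition `P` only selects a
subfamily. -/
lemma summable_weightedSum (hσ : ∀ j, (σ j : Kv v)⁻¹ ∈ Av v) {φ : (Fin r → F[X]) → Kv v}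
    (hφ : VAdicUniform v φ) (P : (Fin r → ℕ) → Prop) :
    Summable fun i : {i // P i} => weightedSum v σ φ i.1 := by
  suffices Summable (weightedSum v σ φ) from this.comp_injective Subtype.val_injective
  refine NonarchimedeanAddGroup.summable_of_tendsto_cofinite_zero (tendsto_def.2 fun U hU => ?_)
  obtain ⟨N, hN⟩ := exists_level_subset v hU
  obtain ⟨e, he⟩ := hφ N
  refine (Set.Finite.pi' fun _ : Fin r => Set.finite_Iic (v ^ e).natDegree).subset fun i hi => ?_
  by_contra hcon
  simp only [Set.mem_Iic, Set.mem_ofPred_eq, not_forall, not_le] at hcon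
  obtain ⟨j, hj⟩ := hcon
  exact hi (hN (mul_mem_level v (prod_weight_mem hσ i)
    (sum_monics_mem (pow_ne_zero e hv.out.ne_zero) _ φ i j hj he)))

lemma tsum_weightedSum_mem_level (hσ : ∀ j, (σ j : Kv v)⁻¹ ∈ Av v)
    {φ : (Fin r → F[X]) → Kv v} (hφ : VAdicUniform v φ) {N : ℕ} (hN : ∀ n, φ n ∈ level v N)
    (P : (Fin r → ℕ) → Prop) : ∑' i : {i // P i}, weightedSum v σ φ i.1 ∈ level v N :=
  (isClosed_level v N).mem_of_tendsto (summable_weightedSum hσ hφ P).hasSum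
    (.of_forall fun _ => sum_mem fun i _ => weightedSum_mem_level hσ hN i.1)

end WeightedSum

/-! ### Compact open subsets of `A_v ^ r` and fine partitions. -/

section Tuples
variable {F : Type*} [Field F] (v : F[X]) [hv : Fact (Irreducible v)] {r : ℕ}

lemma exists_maxIdeal_pow_subset {s : Set (Av v)} (hs : s ∈ 𝓝 (0 : Av v)) :
    ∃ e, ((maxIdeal v ^ e : Ideal (Av v)) : Set (Av v)) ⊆ s := by
  obtain ⟨u, hu, hus⟩ := mem_nhds_induced _ _ _ |>.1 hs
  obtain ⟨e, he⟩ := exists_level_subset v hu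
  exact ⟨e, fun x hx => hus (he ((mem_maxIdeal_pow v).1 hx))⟩

lemma exists_forall_mem_subset {V : Set (Fin r → Av v)} (hV : V ∈ 𝓝 (0 : Fin r → Av v)) :
    ∃ e, ∀ x : Fin r → Av v, (∀ j, x j ∈ maxIdeal v ^ e) → x ∈ V := by
  rw [nhds_pi, Filter.mem_pi'] at hV
  obtain ⟨I, s, hs, hsV⟩ := hV
  choose e he using fun j => exists_maxIdeal_pow_subset v (hs j)
  refine ⟨Finset.univ.sup e, fun x hx => hsV fun j _ => he j ?_⟩
  exact Ideal.pow_le_pow_right (Finset.le_sup (Finset.mem_univ j)) (hx j)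

/-- A compact open set is a union of cosets of `(𝔪_v ^ e) ^ r` for some `e`. -/
lemma exists_mem_iff_of_isCompact {U : Set (Fin r → Av v)} (hc : IsCompact U) (ho : IsOpen U) :
    ∃ e, ∀ x y : Fin r → Av v, (∀ j, x j - y j ∈ maxIdeal v ^ e) → (x ∈ U ↔ y ∈ U) := by
  obtain ⟨V, hV, hUV⟩ := compact_open_separated_add_right hc ho subset_rfl
  obtain ⟨e, he⟩ := exists_forall_mem_subset v hV
  have key (x y : Fin r → Av v) (h : ∀ j, x j - y j ∈ maxIdeal v ^ e) (hy : y ∈ U) : x ∈ U := by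
    have := hUV (Set.add_mem_add hy (he (x - y) h))
    rwa [add_sub_cancel] at this
  exact ⟨e, fun x y h => ⟨key y x fun j => by simpa using neg_mem (h j), key x y h⟩⟩

lemma isClopen_unitTuples : IsClopen (unitTuples v r) := by
  have : unitTuples v r = ⋂ j, (fun x : Fin r → Av v => x j) ⁻¹'
      ((maxIdeal v ^ 1 : Ideal (Av v)) : Set (Av v))ᶜ := by
    ext x
    simp [unitTuples]
  rw [this]
  exact isClopen_iInter_of_finite fun j => IsClopen.preimage
    (IsClopen.compl ⟨isClosed_maxIdeal_pow v 1, isOpen_maxIdeal_pow v 1⟩) (continuous_apply j)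

lemma isClopen_box (α : Fin r → F[X]) (e : Fin r → ℕ) : IsClopen (box v α e) := by
  have : box v α e = ⋂ j, (fun x : Fin r → Av v => x j - toAv v (α j)) ⁻¹'
      ((maxIdeal v ^ e j : Ideal (Av v)) : Set (Av v)) := by
    ext x
    simp [box]
  rw [this]
  exact isClopen_iInter_of_finite fun j => IsClopen.preimage
    ⟨isClosed_maxIdeal_pow v (e j), isOpen_maxIdeal_pow v (e j)⟩
    ((continuous_apply j).sub continuous_const)

lemma box_eq_of_mem {α β : Fin r → F[X]} {e : Fin r → ℕ} {x : Fin r → Av v}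
    (hα : x ∈ box v α e) (hβ : x ∈ box v β e) : box v α e = box v β e := by
  have key {α β : Fin r → F[X]} (hα : x ∈ box v α e) (hβ : x ∈ box v β e) :
      box v α e ⊆ box v β e := fun y hy j => by
    have := add_mem (sub_mem (hy j) (hα j)) (hβ j)
    simpa using this
  exact (key hα hβ).antisymm (key hβ hα)

lemma mem_unitTuples_iff_of_sub_mem {e : ℕ} (he : 1 ≤ e) {x y : Fin r → Av v}
    (h : ∀ j, x j - y j ∈ maxIdeal v ^ e) : x ∈ unitTuples v r ↔ y ∈ unitTuples v r := by
  refine forall_congr' fun j => not_congr ?_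
  have := Ideal.pow_le_pow_right he (h j)
  rw [pow_one] at this
  exact ⟨fun hx => by simpa using sub_mem hx this, fun hy => by simpa using add_mem this hy⟩

/-- The partition of `(A_v ∖ 𝔪_v) ^ r` into cosets of `(𝔪_v ^ e) ^ r`. -/
lemma exists_partition [Finite F] (r e : ℕ) :
    ∃ P : Finpartition (unitTuples v r), IsCompactOpenPartition P ∧
      ∀ U ∈ P.parts, ∀ x ∈ U, ∀ y ∈ U, ∀ j, x j - y j ∈ maxIdeal v ^ e := by
  classical
  let cell (α : Fin r → F[X]) : Set (Fin r → Av v) := box v α (fun _ => e) ∩ unitTuples v r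
  let parts := (Fintype.piFinset fun _ : Fin r => (finite_reps v e).toFinset).image cell
  -- Cells that meet coincide; taking the image as a finset merges repetitions.
  have hdisj : parts.SupIndep id := by
    rw [Finset.supIndep_iff_pairwiseDisjoint]
    intro U hU V hV hne
    obtain ⟨α, -, rfl⟩ := Finset.mem_image.1 hU
    obtain ⟨β, -, rfl⟩ := Finset.mem_image.1 hV
    refine Set.disjoint_left.2 fun x hx hx' => hne ?_
    simp only [cell, box_eq_of_mem v hx.1 hx'.1]
  have hsup : parts.sup id = unitTuples v r := by
    refine le_antisymm (Finset.sup_le fun U hU => ?_) fun x hx => ?_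
    · obtain ⟨α, -, rfl⟩ := Finset.mem_image.1 hU
      exact Set.inter_subset_right
    · choose α hα hxα using fun j => exists_rep v (x j) e
      have : cell α ≤ parts.sup id := Finset.le_sup (f := id) (Finset.mem_image_of_mem _
        (Fintype.mem_piFinset.2 fun j => (finite_reps v e).mem_toFinset.2 (hα j)))
      exact this ⟨hxα, hx⟩
  -- Boxes without unit tuples give the empty cell, which a `Finpartition` must not contain.
  refine ⟨Finpartition.ofErase parts hdisj hsup, fun U hU => ?_, fun U hU x hx y hy j => ?_⟩
  · obtain ⟨α, -, rfl⟩ := Finset.mem_image.1 (Finset.mem_of_mem_erase hU)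
    have := (isClopen_box v α fun _ => e).inter (isClopen_unitTuples v (r := r))
    exact ⟨this.isClosed.isCompact, this.isOpen⟩
  · obtain ⟨α, -, rfl⟩ := Finset.mem_image.1 (Finset.mem_of_mem_erase hU)
    simpa using sub_mem (hx.1 j) (hy.1 j)

/-- The tuple in `A_v ^ r` given by a tuple in `A ^ r`. -/
def toAvTuple (n : Fin r → F[X]) : Fin r → Av v := fun j => toAv v (n j)

variable {v} in
lemma vAdicUniform_of_forall {ψ : (Fin r → Av v) → Kv v}
    (hψ : ∀ N : ℕ, ∃ e : ℕ, ∀ x y, (∀ j, x j - y j ∈ maxIdeal v ^ e) → ψ x - ψ y ∈ level v N) :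
    VAdicUniform v fun n => ψ (toAvTuple v n) := fun N => by
  obtain ⟨e, he⟩ := hψ N
  exact ⟨e, fun n m h => he _ _ fun j => (toAv_sub_mem v).2 (h j)⟩

variable {v} in
lemma vAdicUniform_indicator {U : Set (Fin r → Av v)} (hc : IsCompact U) (ho : IsOpen U) :
    VAdicUniform v fun n => U.indicator (1 : (Fin r → Av v) → Kv v) (toAvTuple v n) := by
  classical
  obtain ⟨e, he⟩ := exists_mem_iff_of_isCompact v hc ho
  refine vAdicUniform_of_forall fun N => ⟨e, fun x y h => ?_⟩
  simp [Set.indicator_apply, he x y h]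

variable {v} in
-- This is how the condition on `σ_j` enters: it makes the weights `σ_j ^ (-i_j)` integral.
lemma inv_mem_Av {s : (Kv v)ˣ} (hs : (s : Kv v) ∉ Subtype.val '' (maxIdeal v : Set (Av v))) :
    (s : Kv v)⁻¹ ∈ Av v := by
  rcases (Av v).mem_or_inv_mem (s : Kv v) with h | h
  · have hu : IsUnit (⟨s, h⟩ : Av v) :=
      IsLocalRing.notMem_maximalIdeal.1 fun hm => hs ⟨⟨s, h⟩, hm, rfl⟩
    rw [IsDedekindDomain.HeightOneSpectrum.adicCompletionIntegers.isUnit_iff_valued_eq_one] at hu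
    rw [IsDedekindDomain.HeightOneSpectrum.mem_adicCompletionIntegers, map_inv₀, hu, inv_one]
  · exact h

end Tuples

/-! ### Measures, zeta values and the integral formula. -/

section Integral
variable {F : Type*} [Field F] [Finite F] (v : F[X]) [hv : Fact (Irreducible v)] {r : ℕ}

/-- The function `x_1 ^ {t_1} ⋯ x_r ^ {t_r}` on `(A_v ∖ 𝔪_v) ^ r`. -/
def vpowProd (t : Fin r → Exponent v) (x : Fin r → Av v) : Kv v :=
  ∏ j, (vpow v (x j) (t j) : Kv v)

/-- The measure attached to the index set `P`. -/
def tupleMeasure (P : (Fin r → ℕ) → Prop) (σ : Fin r → (Kv v)ˣ) (U : Set (Fin r → Av v)) : Kv v :=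
  ∑' i : {i // P i}, measureTerm v σ (fun n => toAvTuple v n ∈ U) i.1

/-- The zeta value attached to the index set `P`. -/
def tupleZeta (P : (Fin r → ℕ) → Prop) (s : Fin r → Xv v) : Kv v :=
  ∑' i : {i // P i}, zetaTerm v s i.1

variable {v} {σ : Fin r → (Kv v)ˣ}

lemma vpowProd_sub_mem {x y : Fin r → Av v} (hx : x ∈ unitTuples v r) (hy : y ∈ unitTuples v r)
    {e : ℕ} (h : ∀ j, x j - y j ∈ maxIdeal v ^ e) (t : Fin r → Exponent v) :
    vpowProd v t x - vpowProd v t y ∈ level v e := by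
  have : ∏ j, vpow v (x j) (t j) - ∏ j, vpow v (y j) (t j) ∈ maxIdeal v ^ e := by
    rw [← Ideal.Quotient.eq, map_prod, map_prod]
    exact Finset.prod_congr rfl fun j _ =>
      Ideal.Quotient.eq.2 (vpow_sub_vpow_mem v (hx j) (hy j) (h j) (t j))
  rw [mem_maxIdeal_pow] at this
  simpa [vpowProd] using this

lemma vAdicUniform_vpowProd (t : Fin r → Exponent v) :
    VAdicUniform v fun n => (unitTuples v r).indicator (vpowProd v t) (toAvTuple v n) := by
  -- Congruence modulo at least `𝔪_v` is needed even for `N = 0`, so that both points or neither are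
  -- unit tuples.
  refine vAdicUniform_of_forall fun N => ⟨max N 1, fun x y h => ?_⟩
  have hxy := mem_unitTuples_iff_of_sub_mem v (le_max_right N 1) h
  by_cases hx : x ∈ unitTuples v r
  · rw [Set.indicator_of_mem hx, Set.indicator_of_mem (hxy.1 hx)]
    exact level_anti v (le_max_left N 1) (vpowProd_sub_mem hx (hxy.1 hx) h t)
  · rw [Set.indicator_of_notMem hx, Set.indicator_of_notMem (hxy.not.1 hx), sub_zero]
    exact zero_mem _

lemma measureTerm_congr {p p' : (Fin r → F[X]) → Prop} (h : ∀ n, p n ↔ p' n) (i : Fin r → ℕ) :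
    measureTerm v σ p i = measureTerm v σ p' i := by
  rw [show p = p' from funext fun n => propext (h n)]

lemma measureTerm_eq_weightedSum (U : Set (Fin r → Av v)) (i : Fin r → ℕ) :
    measureTerm v σ (fun n => toAvTuple v n ∈ U) i =
      weightedSum v σ (fun n => U.indicator (1 : (Fin r → Av v) → Kv v) (toAvTuple v n)) i := by
  classical
  simp [measureTerm, weightedSum, monicTuples, Set.indicator_apply]

lemma powerSum_eq (s : (Kv v)ˣ) (t : Exponent v) (i : ℕ) :
    powerSum v (s, -t) i = (s : Kv v)⁻¹ ^ i * ∑ n ∈ monics F i,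
      {x | x ∉ maxIdeal v}.indicator (fun x => (vpow v x t : Kv v)) (toAv v n) := by
  classical
  rw [powerSum, Finset.sum_filter, Finset.mul_sum]
  refine Finset.sum_congr rfl fun n hn => ?_
  by_cases h : IsCoprime n v
  · have hx := (isCoprime_iff_toAv v).1 h
    have h1 : (vpow v (toAv v n) (-t) : Kv v) * vpow v (toAv v n) t = 1 :=
      congrArg Subtype.val (vpow_neg_mul_vpow v hx t)
    rw [if_pos h, Set.indicator_of_mem (by simpa using hx), charPow, (mem_monics.1 hn).2,
      eq_inv_of_mul_eq_one_right h1, one_div, mul_inv, inv_pow]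
  · have hx := (isCoprime_iff_toAv v).not.1 h
    rw [if_neg h, Set.indicator_of_notMem (by simpa using hx), mul_zero]

/-- The product of power sums expands into a sum over tuples, where the product of the coprimality
indicators is the indicator of `unitTuples`. -/
lemma zetaTerm_eq_weightedSum (t : Fin r → Exponent v) (i : Fin r → ℕ) :
    zetaTerm v (fun j => (σ j, -t j)) i =
      weightedSum v σ (fun n => (unitTuples v r).indicator (vpowProd v t) (toAvTuple v n)) i := by
  classical
  simp only [zetaTerm, powerSum_eq, Finset.prod_mul_distrib, Finset.prod_univ_sum, weightedSum]
  congr 1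
  refine Finset.sum_congr rfl fun n _ => ?_
  by_cases h : toAvTuple v n ∈ unitTuples v r
  · rw [Set.indicator_of_mem h]
    exact Finset.prod_congr rfl fun j _ => Set.indicator_of_mem
      (s := {x : Av v | x ∉ maxIdeal v}) (Set.mem_ofPred.2 (h j)) _
  · rw [Set.indicator_of_notMem h]
    simp only [unitTuples, Set.mem_ofPred_eq, not_forall] at h
    obtain ⟨j, hj⟩ := h
    refine Finset.prod_eq_zero (Finset.mem_univ j) (Set.indicator_of_notMem ?_ _)
    rw [Set.mem_ofPred_eq]
    exact hj

lemma hasSum_tupleMeasure (hσ : ∀ j, (σ j : Kv v)⁻¹ ∈ Av v) (P : (Fin r → ℕ) → Prop)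
    {U : Set (Fin r → Av v)} (hc : IsCompact U) (ho : IsOpen U) :
    HasSum (fun i : {i // P i} => measureTerm v σ (fun n => toAvTuple v n ∈ U) i.1)
      (tupleMeasure v P σ U) := by
  refine Summable.hasSum ?_
  simp only [measureTerm_eq_weightedSum]
  exact summable_weightedSum hσ (vAdicUniform_indicator hc ho) P

lemma isMeasureValuedIn_tupleMeasure (hσ : ∀ j, (σ j : Kv v)⁻¹ ∈ Av v)
    (P : (Fin r → ℕ) → Prop) :
    IsMeasureValuedIn (Av v : Set (Kv v)) (tupleMeasure v P σ) where
  mem U hc ho := by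
    classical
    refine (mem_level_zero v).1 ?_
    simp only [tupleMeasure, measureTerm_eq_weightedSum]
    refine tsum_weightedSum_mem_level hσ (vAdicUniform_indicator hc ho) (fun n => ?_) P
    rw [mem_level_zero, Set.indicator_apply]
    split_ifs
    · exact one_mem _
    · exact zero_mem _
  empty := by simp [tupleMeasure, measureTerm, monicTuples]
  union U V hcU hoU hcV hoV hd := by
    refine (hasSum_tupleMeasure hσ P (hcU.union hcV) (hoU.union hoV)).unique ?_
    convert (hasSum_tupleMeasure hσ P hcU hoU).add (hasSum_tupleMeasure hσ P hcV hoV) using 2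
      with i
    simp only [measureTerm_eq_weightedSum, weightedSum, ← mul_add, ← Finset.sum_add_distrib,
      Set.indicator_union_of_disjoint hd]

lemma hasSum_tupleMeasure_box (hσ : ∀ j, (σ j : Kv v)⁻¹ ∈ Av v) (P : (Fin r → ℕ) → Prop)
    (α : Fin r → F[X]) (e : Fin r → ℕ) :
    HasSum (fun i : {i // P i} => measureTerm v σ (fun n => ∀ j, v ^ e j ∣ n j - α j) i.1)
      (tupleMeasure v P σ (box v α e)) := by
  have h := isClopen_box v α e
  convert hasSum_tupleMeasure hσ P h.isClosed.isCompact h.isOpen using 2 with i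
  refine measureTerm_congr (fun n => ?_) _
  simp [box, toAvTuple, toAv_sub_mem]

lemma summable_zetaTerm (hσ : ∀ j, (σ j : Kv v)⁻¹ ∈ Av v) (P : (Fin r → ℕ) → Prop)
    (t : Fin r → Exponent v) :
    Summable fun i : {i // P i} => zetaTerm v (fun j => (σ j, -t j)) i.1 := by
  simp only [zetaTerm_eq_weightedSum]
  exact summable_weightedSum hσ (vAdicUniform_vpowProd t) P

/-- A Riemann sum for a sufficiently fine partition differs little from the integrand at every
point. -/
lemma riemannSum_sub_mem {e : ℕ} (t : Fin r → Exponent v) (Q : Finpartition (unitTuples v r))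
    (hQ : ∀ U ∈ Q.parts, ∀ x ∈ U, ∀ y ∈ U, ∀ j, x j - y j ∈ maxIdeal v ^ e)
    {ξ : Set (Fin r → Av v) → Fin r → Av v} (hξ : ∀ U ∈ Q.parts, ξ U ∈ U) (x : Fin r → Av v) :
    ∑ U ∈ Q.parts, vpowProd v t (ξ U) * U.indicator 1 x -
      (unitTuples v r).indicator (vpowProd v t) x ∈ level v e := by
  classical
  by_cases hx : x ∈ unitTuples v r
  · obtain ⟨U, hU, hxU⟩ : ∃ U ∈ Q.parts, x ∈ U := by
      have h := hx
      rw [← Q.sup_parts, Finset.sup_set_eq_biUnion] at h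
      simpa using h
    rw [Finset.sum_eq_single_of_mem U hU, Set.indicator_of_mem hxU, Set.indicator_of_mem hx,
      Pi.one_apply, mul_one]
    · exact vpowProd_sub_mem (Q.le hU (hξ U hU)) hx (hQ U hU _ (hξ U hU) _ hxU) t
    · intro V hV hne
      have hxV : x ∉ V := fun h => Set.disjoint_left.1 (Q.disjoint hV hU hne) h hxU
      rw [Set.indicator_of_notMem hxV, mul_zero]
  · rw [Set.indicator_of_notMem hx, sub_zero, Finset.sum_eq_zero]
    · exact zero_mem _
    · intro U hU
      rw [Set.indicator_of_notMem fun h => hx (Q.le hU h), mul_zero]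

/-- Riemann sum and zeta value are series over the same index set. Their termwise difference is the
weighted sum of a function with values in `level v e`, by `riemannSum_sub_mem`; this closed subgroup
then contains the difference of the sums. -/
lemma hasIntegral_tupleMeasure (hσ : ∀ j, (σ j : Kv v)⁻¹ ∈ Av v) (P : (Fin r → ℕ) → Prop)
    (t : Fin r → Exponent v) :
    HasIntegral (tupleMeasure v P σ) (unitTuples v r) (vpowProd v t)
      (tupleZeta v P fun j => (σ j, -t j)) := by
  intro N hN
  obtain ⟨e, he⟩ := exists_level_add_subset v hN
  obtain ⟨P₀, hP₀, hfine⟩ := exists_partition v r e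
  refine ⟨P₀, hP₀, fun Q hQ hle ξ hξ => he _ ?_⟩
  have hQe : ∀ U ∈ Q.parts, ∀ x ∈ U, ∀ y ∈ U, ∀ j, x j - y j ∈ maxIdeal v ^ e := by
    intro U hU x hx y hy
    obtain ⟨V, hV, hUV⟩ := hle hU
    exact hfine V hV x (hUV hx) y (hUV hy)
  have hsum := (hasSum_sum fun U hU => (hasSum_tupleMeasure hσ P (hQ U hU).1 (hQ U hU).2).mul_left
    (vpowProd v t (ξ U))).sub (summable_zetaTerm hσ P t).hasSum
  refine (isClosed_level v e).mem_of_tendsto hsum (.of_forall fun _ => sum_mem fun i _ => ?_)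
  convert weightedSum_mem_level hσ
    (fun n => riemannSum_sub_mem t Q hQe hξ (toAvTuple v n)) i.1 using 1
  simp only [measureTerm_eq_weightedSum, zetaTerm_eq_weightedSum, weightedSum,
    Finset.sum_sub_distrib, mul_sub]
  congr 1
  rw [Finset.sum_comm, Finset.mul_sum]
  refine Finset.sum_congr rfl fun U _ => ?_
  rw [← Finset.mul_sum, mul_left_comm]

end Integral
end VAdicMZ
end

theorem mainTheorem3 {F : Type*} [Field F] [Finite F] (v : Polynomial F) [Fact (Irreducible v)]
    (_hmonic : v.Monic) (r : ℕ) (σ : Fin r → (VAdicMZ.Kv v)ˣ)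
    (hσ : ∀ j, (σ j : VAdicMZ.Kv v) ∉ Subtype.val '' (VAdicMZ.maxIdeal v : Set (VAdicMZ.Av v))) :
    -- the powers `x ^ t` are well defined
    (∀ x : VAdicMZ.Av v, x ∉ VAdicMZ.maxIdeal v → ∀ t : VAdicMZ.Exponent v,
      Tendsto (VAdicMZ.powApprox v x t) atTop (𝓝 (VAdicMZ.vpow v x t))) ∧
    -- `μ` and `μ⋆` are `A_v`-valued measures with the prescribed values
    VAdicMZ.IsMeasureValuedIn (VAdicMZ.Av v : Set (VAdicMZ.Kv v)) (VAdicMZ.zetaMeasure v σ) ∧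
    VAdicMZ.IsMeasureValuedIn (VAdicMZ.Av v : Set (VAdicMZ.Kv v)) (VAdicMZ.zetaStarMeasure v σ) ∧
    (∀ (α : Fin r → Polynomial F) (e : Fin r → ℕ),
      HasSum (fun i : VAdicMZ.StrictIdx r =>
          VAdicMZ.measureTerm v σ (fun n => ∀ j, v ^ e j ∣ n j - α j) i.1)
        (VAdicMZ.zetaMeasure v σ (VAdicMZ.box v α e)) ∧
      HasSum (fun i : VAdicMZ.WeakIdx r =>
          VAdicMZ.measureTerm v σ (fun n => ∀ j, v ^ e j ∣ n j - α j) i.1)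
        (VAdicMZ.zetaStarMeasure v σ (VAdicMZ.box v α e))) ∧
    -- the integral expressions
    ∀ t : Fin r → VAdicMZ.Exponent v,
      (Summable (fun i : VAdicMZ.StrictIdx r =>
          VAdicMZ.zetaTerm v (fun j => (σ j, -t j)) i.1) ∧
        VAdicMZ.HasIntegral (VAdicMZ.zetaMeasure v σ) (VAdicMZ.unitTuples v r)
          (fun x => ∏ j, (VAdicMZ.vpow v (x j) (t j) : VAdicMZ.Kv v))
          (VAdicMZ.vMZF v (fun j => (σ j, -t j)))) ∧
      (Summable (fun i : VAdicMZ.WeakIdx r =>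
          VAdicMZ.zetaTerm v (fun j => (σ j, -t j)) i.1) ∧
        VAdicMZ.HasIntegral (VAdicMZ.zetaStarMeasure v σ) (VAdicMZ.unitTuples v r)
          (fun x => ∏ j, (VAdicMZ.vpow v (x j) (t j) : VAdicMZ.Kv v))
          (VAdicMZ.vMZSF v (fun j => (σ j, -t j)))) := by
  have hσ' := fun j => VAdicMZ.inv_mem_Av (hσ j)
  -- The measures and zeta functions unfold to `tupleMeasure` and `tupleZeta` with `P` equal to
  -- `StrictAnti` or `Antitone`.
  exact ⟨fun x hx t => VAdicMZ.tendsto_powApprox v hx t,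
    VAdicMZ.isMeasureValuedIn_tupleMeasure hσ' StrictAnti,
    VAdicMZ.isMeasureValuedIn_tupleMeasure hσ' Antitone,
    fun α e => ⟨VAdicMZ.hasSum_tupleMeasure_box hσ' StrictAnti α e,
      VAdicMZ.hasSum_tupleMeasure_box hσ' Antitone α e⟩,
    fun t => ⟨⟨VAdicMZ.summable_zetaTerm hσ' StrictAnti t,
        VAdicMZ.hasIntegral_tupleMeasure hσ' StrictAnti t⟩,
      ⟨VAdicMZ.summable_zetaTerm hσ' Antitone t,
        VAdicMZ.hasIntegral_tupleMeasure hσ' Antitone t⟩⟩⟩
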